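/- Let $\mathcal X,\mathcal Y$ be sets of finite objects (countable, effectively coded by natural numbers). A conditional distribution $q(y|x)$ on $\mathcal Y$ given $x\in\mathcal X$ is \emph{computable} if there is an algorithm that, on input $(x,y,n)$, halts with a natural number $m$ such that $|q(y|x)-m2^{-n}|\le 2^{-n}$. Fix a universal (additively optimal) prefix-free machine $U$; the Kolmogorov complexity $K(q)$, in nats, is $\log 2$ times the length of a shortest self-delimiting program with which $U$ outputs an algorithm computing $q$. For a dataset $\mathcal D=((x_i,y_i))_{i=1}^N$ let $L_{\mathcal D}(q)=\sum_{i=1}^N-\log q(y_i|x_i)\in[0,\infty]$ and \[ C(\mathcal D)=\min_{q} \big(L_{\mathcal D}(q)+K(q)\big), \] the minimum being over all computable conditional distributions $q(y|x)$. Let $p(x,y)$ be a probability distribution on $\mathcal X\times\mathcal Y$ such that $p(y|x)$ is computable, i.e. some computable $q$ satisfies $q(\cdot|x)=p(\cdot|x)$ for all $x$ with $p(x)>0$ (we then say that $q$ is $p(y|x)$). Let $K(p(y|x))$ be the least $K(q)$ over all such $q$ (there is only one if $p(x)>0$ for all $x$), and let $H_p(y|x)=\sum_{x,y}p(x,y)\,(-\log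 p(y|x))\in[0,\infty]$ be the conditional entropy. Let $(x_i,y_i)_{i\ge1}$ be i.i.d. samples from $p(x,y)$ and let $\mathcal D_N=((x_i,y_i))_{i=1}^N$. Then: 1. For every $N\ge 0$, \[ N\, H_p(y|x)\le\mathbb E[C(\mathcal D_N)]\le N\, H_p(y|x)+K(p(y|x)). \] 2. For every $\epsilon>0$ there is $N_0$ such that, with probability at least $1-\epsilon$, simultaneously for all $N\ge N_0$: \[ C(\mathcal D_N)=L_{\mathcal D_N}(p(y|x))+K(p(y|x)), \] and $p(y|x)$ is the only computable distribution attaining this: a computable $q$ satisfies $C(\mathcal D_N)=L_{\mathcal D_N}(q)+K(q)$ if and only if $q$ is $p(y|x)$ and $K(q)=K(p(y|x))$. Moreover, if $H_p(y|x)<\infty$, then on the same event $C(\mathcal D_N)=N\,H_p(y|x)+K(p(y|x))$ up to an error of absolute value at most $\epsilon N$, for all $N\ge N_0$. 3. If $\mathcal Y$ is finite, then for every $\epsilon>0$ there are $N_0$ and $c$ such that, for every $N\ge N_0$, with probability at least $1-\epsilon$, \[ \big|C(\mathcal D_N)-\big(N\,H_p(y|x)+K(p(y|x))\big)\big|\le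 c\sqrt N . \] -/

import Mathlib

open MeasureTheory ProbabilityTheory
open scoped ENNReal

namespace TaskComplexity

noncomputable section

/-! Prefix Kolmogorov complexity -/

/-- A prefix machine: a partial computable function on binary strings whose domain is
prefix-free (programs are self-delimiting). Outputs are finite objects coded by naturals. -/
def IsPrefixMachine (U : List Bool →. ℕ) : Prop :=
  Partrec U ∧ ∀ u v : List Bool, (U u).Dom → (U v).Dom → u <+: v → u = v

/-- The length in bits of a shortest program with which `U` outputs `n` (`⊤` if there is none). -/
def programLength (U : List Bool →. ℕ) (n : ℕ) : ℕ∞ :=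
  ⨅ (w : List Bool) (_ : n ∈ U w), (w.length : ℕ∞)

/-- A universal (additively optimal) prefix machine, the reference machine of prefix Kolmogorov
complexity. -/
def IsUniversalPrefixMachine (U : List Bool →. ℕ) : Prop :=
  IsPrefixMachine U ∧
    ∀ T : List Bool →. ℕ, IsPrefixMachine T →
      ∃ c : ℕ, ∀ n : ℕ, programLength U n ≤ programLength T n + c

/-! Computable conditional distributions and their complexity -/

variable {X Y : Type*}

/-- The algorithm `c` computes the conditional distribution `q(y|x)`: on input `(x, y, n)` it halts
with a natural number `m` such that the dyadic rational `m / 2 ^ n` is within `2 ^ (-n)` of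
`q(y|x)`. -/
def Computes [Primcodable X] [Primcodable Y] (c : Nat.Partrec.Code) (q : X → PMF Y) : Prop :=
  ∀ (x : X) (y : Y) (n : ℕ), ∃ m ∈ c.eval (Encodable.encode (x, y, n)),
    |(q x y).toReal - (m : ℝ) / 2 ^ n| ≤ 1 / 2 ^ n

/-- `q(y|x)` is a computable conditional distribution. -/
def IsComputable [Primcodable X] [Primcodable Y] (q : X → PMF Y) : Prop :=
  ∃ c : Nat.Partrec.Code, Computes c q

/-- The Kolmogorov complexity `K(q)` in nats: the length of a shortest self-delimiting program
producing an algorithm that computes `q`, times `log 2`. -/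
def complexity [Primcodable X] [Primcodable Y] (U : List Bool →. ℕ) (q : X → PMF Y) : ℝ≥0∞ :=
  ⨅ (c : Nat.Partrec.Code) (_ : Computes c q),
    (programLength U (Encodable.encode c) : ℝ≥0∞) * ENNReal.ofReal (Real.log 2)

/-! Losses and the complexity of a dataset -/

/-- `- log a` for a probability `a`, with value `∞` at `a = 0` (natural logarithm). -/
def negLog (a : ℝ≥0∞) : ℝ≥0∞ :=
  if a = 0 then ⊤ else ENNReal.ofReal (-Real.log a.toReal)

/-- The empirical cross-entropy loss `∑ i, - log f(y_i | x_i)` of a dataset. -/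
def loss (f : X → Y → ℝ≥0∞) {N : ℕ} (D : Fin N → X × Y) : ℝ≥0∞ :=
  ∑ i, negLog (f (D i).1 (D i).2)

/-- The complexity `C(D)` of a dataset: the minimum over all computable conditional distributions
`q(y|x)` of the loss of `q` on `D` plus `K(q)`. -/
def taskComplexity [Primcodable X] [Primcodable Y] (U : List Bool →. ℕ)
    {N : ℕ} (D : Fin N → X × Y) : ℝ≥0∞ :=
  ⨅ (q : X → PMF Y) (_ : IsComputable q), loss (fun x y => q x y) D + complexity U q

/-! The conditional of a joint distribution -/

/-- `p(y|x) = p(x,y) / p(x)`; meaningful when `p(x) ≠ 0`. -/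
def condProb (p : PMF (X × Y)) (x : X) (y : Y) : ℝ≥0∞ :=
  p (x, y) / (p.map Prod.fst) x

/-- `q` is the conditional distribution `p(y|x)`, i.e. it agrees with it at every input `x` at
which `p(y|x)` is defined, that is `p(x) ≠ 0`. -/
def IsConditional (p : PMF (X × Y)) (q : X → PMF Y) : Prop :=
  ∀ x, (p.map Prod.fst) x ≠ 0 → ∀ y, q x y = condProb p x y

/-- `p(y|x)` is computable. -/
def HasComputableConditional [Primcodable X] [Primcodable Y] (p : PMF (X × Y)) : Prop :=
  ∃ q : X → PMF Y, IsComputable q ∧ IsConditional p q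

/-- `K(p(y|x))`: the least complexity of a computable conditional distribution that is `p(y|x)`.
There is only one such distribution if `p(x) ≠ 0` for all `x`. -/
def conditionalComplexity [Primcodable X] [Primcodable Y] (U : List Bool →. ℕ)
    (p : PMF (X × Y)) : ℝ≥0∞ :=
  ⨅ (q : X → PMF Y) (_ : IsComputable q) (_ : IsConditional p q), complexity U q

/-- The conditional entropy `H_p(y|x) = ∑ p(x,y) (- log p(y|x))` in nats. -/
def condEntropy (p : PMF (X × Y)) : ℝ≥0∞ :=
  ∑' z : X × Y, p z * negLog (condProb p z.1 z.2)

/-- The dataset consisting of the first `N` samples. -/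
def sample {Ω : Type*} (Z : ℕ → Ω → X × Y) (N : ℕ) (ω : Ω) : Fin N → X × Y :=
  fun i => Z i ω

end

end TaskComplexity

namespace TaskComplexity

/-! Kraft's inequality for prefix machines -/

/-! Give each algorithm `i`, computing `q_i`, the weight `w_i = 2 ^ (-length)` of its shortest
program. Shortest programs of distinct algorithms are distinct words of a prefix-free set, so
Kraft's inequality gives `∑ w_i ≤ 1`. Hence `C(D)` is a countable infimum of `-log (w_i ∏
q_i(y_k|x_k))`, and it is compared with the loss of `p(y|x)` through the products `R_i` of the
likelihood ratios `q_i(y|x) / p(y|x)`, each factor of which has mean at most 1.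

Expectation: the upper bound inserts `p(y|x)` itself. For the lower bound, `log t ≤ t - 1` gives
`loss + 1 ≤ C + ∑ w_i R_i` for the loss of `p(y|x)`; the mixture on the right has mean at most `∑
w_i ≤ 1`, and the two ones cancel.

Exact minimizer: let `i₀` be a shortest algorithm for `p(y|x)`. An algorithm `i` for something else
loses to it as soon as `w_i R_i < w_{i₀}`. For a single `i` this happens eventually, almost surely,
because the Bhattacharyya coefficient is less than one (`ae_tendsto_prod_zero`). All but finitely
many `i` are handled at once by Ville's inequality for the tail of the mixture, whose initial value
is a tail of `∑ w_i` (`ae_eventually_forall_mul_prod_lt`).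

After that only the loss of `p(y|x)` fluctuates: the law of large numbers gives the error `ε N`. For
finite `Y` its second moment is finite, and Chebyshev's inequality gives the error `c √N`. -/

theorem uniquelyDecodable_of_prefixFree {α : Type*} {S : Set (List α)}
    (hnil : [] ∉ S) (hS : ∀ u ∈ S, ∀ v ∈ S, u <+: v → u = v) :
    InformationTheory.UniquelyDecodable S := by
  intro L₁
  induction L₁ with
  | nil =>
    intro L₂ _ h₂ h
    cases L₂ with
    | nil => rfl
    | cons v L₂ =>
      have hv : v = [] := by
        have := h.symm
        simp at this
        exact this.1
      exact absurd (hv ▸ h₂ v (by simp)) hnil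
  | cons u L₁ ih =>
    intro L₂ h₁ h₂ h
    cases L₂ with
    | nil =>
      have hu : u = [] := by
        simp at h
        exact h.1
      exact absurd (hu ▸ h₁ u (by simp)) hnil
    | cons v L₂ =>
      have huv : u = v := by
        simp only [List.flatten_cons] at h
        -- Both first words are prefixes of the same string, hence comparable, hence equal.
        rcases List.prefix_or_prefix_of_prefix (List.prefix_append u L₁.flatten)
          (h ▸ List.prefix_append v L₂.flatten) with h' | h'
        · exact hS u (h₁ u (by simp)) v (h₂ v (by simp)) h'
        · exact (hS v (h₂ v (by simp)) u (h₁ u (by simp)) h').symm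
      subst huv
      simp only [List.flatten_cons, List.append_cancel_left_eq] at h
      rw [ih L₂ (fun w hw => h₁ w (by simp [hw])) (fun w hw => h₂ w (by simp [hw])) h]

theorem sum_two_inv_pow_length_le_one {S : Finset (List Bool)}
    (hS : ∀ u ∈ S, ∀ v ∈ S, u <+: v → u = v) :
    ∑ w ∈ S, (2⁻¹ : ℝ≥0∞) ^ w.length ≤ 1 := by
  -- Unique decodability fails in the presence of the empty word, but a prefix-free set containing
  -- it is the singleton `{[]}`.
  by_cases hnil : [] ∈ S
  · have : S = {[]} := by
      ext v
      simp only [Finset.mem_singleton]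
      exact ⟨fun hv => (hS [] hnil v hv List.nil_prefix).symm, fun hv => hv ▸ hnil⟩
    simp [this]
  · have h := InformationTheory.kraft_mcmillan_inequality (S := S)
      (uniquelyDecodable_of_prefixFree (S := (S : Set (List Bool))) (by simpa using hnil)
        (by simpa using hS))
    have h2 : ∑ w ∈ S, (2⁻¹ : ℝ≥0∞) ^ w.length
        = ENNReal.ofReal (∑ w ∈ S, (1 / Fintype.card Bool : ℝ) ^ w.length) := by
      rw [ENNReal.ofReal_sum_of_nonneg (fun _ _ => by positivity)]
      refine Finset.sum_congr rfl fun w _ => ?_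
      rw [ENNReal.ofReal_pow (by positivity)]
      congr 1
      simp [ENNReal.ofReal_inv_of_pos]
    rw [h2]
    simpa using ENNReal.ofReal_le_ofReal h

section

variable {U : List Bool →. ℕ}

theorem programLength_le_of_mem {w : List Bool} {n : ℕ} (h : n ∈ U w) :
    programLength U n ≤ w.length :=
  iInf₂_le w h

theorem exists_mem_length_eq {n : ℕ} (h : programLength U n ≠ ⊤) :
    ∃ w, n ∈ U w ∧ (w.length : ℕ∞) = programLength U n := by
  have hne : Nonempty {w // n ∈ U w} := by
    by_contra hemp
    refine h ?_
    simp only [nonempty_subtype, not_exists] at hemp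
    simp [programLength, hemp]
  have h1 : programLength U n = ⨅ w : {w // n ∈ U w}, (w.1.length : ℕ∞) := by
    rw [programLength, iInf_subtype']
  obtain ⟨w, hw⟩ := ciInf_mem (fun w : {w // n ∈ U w} => (w.1.length : ℕ∞))
  exact ⟨w.1, w.2, by rw [h1]; exact hw⟩

/-- A machine whose only program is the empty word: comparison with it shows that a universal
machine has a program for every `n`. -/
theorem isPrefixMachine_single (n : ℕ) :
    IsPrefixMachine (fun w => if w = [] then Part.some n else Part.none) := by
  constructor
  · have hp : PrimrecPred fun w : List Bool => w = [] := Primrec.eq.comp .id (.const [])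
    obtain ⟨d, hp⟩ := hp
    have := Partrec.cond (c := fun w : List Bool => decide (w = [])) (f := fun _ => Part.some n)
      (g := fun _ => Part.none) (by convert hp.to_comp) (Computable.const n).partrec Partrec.none
    refine this.of_eq fun w => ?_
    by_cases hw : w = [] <;> simp [hw]
  · intro u v hu hv _
    have key : ∀ w : List Bool,
        (if w = [] then Part.some n else Part.none : Part ℕ).Dom → w = [] := by
      intro w hw
      by_contra h
      simp [h] at hw
    rw [key u hu, key v hv]

theorem IsUniversalPrefixMachine.programLength_ne_top (hU : IsUniversalPrefixMachine U) (n : ℕ) :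
    programLength U n ≠ ⊤ := by
  obtain ⟨c, hc⟩ := hU.2 _ (isPrefixMachine_single n)
  have h0 : programLength (fun w => if w = [] then Part.some n else Part.none) n ≤ 0 := by
    simpa using programLength_le_of_mem
      (U := fun w => if w = [] then Part.some n else Part.none) (w := []) (n := n) (by simp)
  intro h
  have := (hc n).trans (add_le_add_left h0 _)
  rw [h] at this
  simp at this

theorem IsUniversalPrefixMachine.tsum_two_inv_pow_le_one (hU : IsUniversalPrefixMachine U) :
    ∑' n, (2⁻¹ : ℝ≥0∞) ^ (programLength U n).toNat ≤ 1 := by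
  choose w hw hl using fun n => exists_mem_length_eq (hU.programLength_ne_top n)
  have hinj : Function.Injective w := fun m n h => Part.mem_unique (hw m) (h ▸ hw n)
  rw [ENNReal.tsum_eq_iSup_sum]
  refine iSup_le fun s => ?_
  have hsum : ∑ n ∈ s, (2⁻¹ : ℝ≥0∞) ^ (programLength U n).toNat
      = ∑ v ∈ s.map ⟨w, hinj⟩, (2⁻¹ : ℝ≥0∞) ^ v.length := by
    rw [Finset.sum_map]
    refine Finset.sum_congr rfl fun n _ => ?_
    rw [← hl n]
    rfl
  rw [hsum]
  refine sum_two_inv_pow_length_le_one fun u hu v hv huv => ?_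
  simp only [Finset.mem_map, Function.Embedding.coeFn_mk] at hu hv
  obtain ⟨m, -, rfl⟩ := hu
  obtain ⟨n, -, rfl⟩ := hv
  exact hU.1.2 _ _ (Part.dom_iff_mem.2 ⟨m, hw m⟩) (Part.dom_iff_mem.2 ⟨n, hw n⟩) huv

end

/-! The logarithmic loss -/

section

theorem negLog_of_ne_zero {a : ℝ≥0∞} (h : a ≠ 0) :
    negLog a = ENNReal.ofReal (-Real.log a.toReal) := by
  simp [negLog, h]

theorem negLog_ne_top {a : ℝ≥0∞} (h : a ≠ 0) : negLog a ≠ ⊤ := by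
  simp [negLog_of_ne_zero h]

@[simp] theorem negLog_one : negLog 1 = 0 := by simp [negLog]

@[simp] theorem negLog_zero : negLog 0 = ⊤ := by simp [negLog]

theorem toReal_pos_le_one {a : ℝ≥0∞} (h0 : a ≠ 0) (h1 : a ≤ 1) :
    0 < a.toReal ∧ a.toReal ≤ 1 :=
  ⟨ENNReal.toReal_pos h0 (ne_top_of_le_ne_top ENNReal.one_ne_top h1),
    ENNReal.toReal_le_of_le_ofReal zero_le_one (by simpa using h1)⟩

theorem negLog_mul {a b : ℝ≥0∞} (ha : a ≤ 1) (hb : b ≤ 1) :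
    negLog (a * b) = negLog a + negLog b := by
  by_cases ha0 : a = 0
  · simp [ha0]
  by_cases hb0 : b = 0
  · simp [hb0]
  obtain ⟨ha1, ha2⟩ := toReal_pos_le_one ha0 ha
  obtain ⟨hb1, hb2⟩ := toReal_pos_le_one hb0 hb
  rw [negLog_of_ne_zero ha0, negLog_of_ne_zero hb0, negLog_of_ne_zero (mul_ne_zero ha0 hb0),
    ← ENNReal.ofReal_add (by simpa using Real.log_nonpos ha1.le ha2)
      (by simpa using Real.log_nonpos hb1.le hb2),
    ENNReal.toReal_mul, Real.log_mul ha1.ne' hb1.ne']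
  congr 1
  ring

theorem negLog_prod {ι : Type*} (s : Finset ι) {f : ι → ℝ≥0∞} (hf : ∀ i ∈ s, f i ≤ 1) :
    negLog (∏ i ∈ s, f i) = ∑ i ∈ s, negLog (f i) := by
  classical
  induction s using Finset.induction_on with
  | empty => simp
  | insert i s hi ih =>
    rw [Finset.prod_insert hi, Finset.sum_insert hi, negLog_mul (hf i (by simp))
      (Finset.prod_le_one' fun j hj => hf j (by simp [hj])),
      ih fun j hj => hf j (by simp [hj])]

theorem negLog_two_inv_pow (n : ℕ) :
    negLog (2⁻¹ ^ n) = (n : ℝ≥0∞) * ENNReal.ofReal (Real.log 2) := by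
  rw [negLog_of_ne_zero (by simp), ← ENNReal.ofReal_natCast, ← ENNReal.ofReal_mul (by positivity)]
  simp

theorem negLog_lt_negLog {a b : ℝ≥0∞} (h : a < b) (hb : b ≤ 1) : negLog b < negLog a := by
  have hb0 : b ≠ 0 := (zero_le.trans_lt h).ne'
  by_cases ha0 : a = 0
  · rw [ha0, negLog_zero]
    exact (negLog_ne_top hb0).lt_top
  obtain ⟨ha1, ha2⟩ := toReal_pos_le_one ha0 (h.le.trans hb)
  have hab : a.toReal < b.toReal :=
    (ENNReal.toReal_lt_toReal h.ne_top (ne_top_of_le_ne_top ENNReal.one_ne_top hb)).2 h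
  have hb2 := (toReal_pos_le_one hb0 hb).2
  rw [negLog_of_ne_zero ha0, negLog_of_ne_zero hb0]
  refine (ENNReal.ofReal_lt_ofReal_iff ?_).2 (neg_lt_neg (Real.log_lt_log ha1 hab))
  have := Real.log_neg ha1 (hab.trans_le hb2)
  linarith

/-- This is `log t ≤ t - 1` at `t = a / b`, rearranged so that no subtraction occurs in `ℝ≥0∞`. -/
theorem negLog_add_one_le {a b : ℝ≥0∞} (ha : a ≤ 1) (hb : b ≤ 1) (hb0 : b ≠ 0) :
    negLog b + 1 ≤ negLog a + a / b := by
  by_cases ha0 : a = 0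
  · simp [ha0]
  obtain ⟨ha1, ha2⟩ := toReal_pos_le_one ha0 ha
  obtain ⟨hb1, hb2⟩ := toReal_pos_le_one hb0 hb
  have hla := Real.log_nonpos ha1.le ha2
  have hlb := Real.log_nonpos hb1.le hb2
  have hdiv : a / b = ENNReal.ofReal (a.toReal / b.toReal) := by
    rw [ENNReal.ofReal_div_of_pos hb1, ENNReal.ofReal_toReal, ENNReal.ofReal_toReal] <;>
      exact ne_top_of_le_ne_top ENNReal.one_ne_top (by assumption)
  rw [negLog_of_ne_zero ha0, negLog_of_ne_zero hb0, hdiv, ← ENNReal.ofReal_one,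
    ← ENNReal.ofReal_add (by linarith) zero_le_one,
    ← ENNReal.ofReal_add (by linarith) (by positivity)]
  refine ENNReal.ofReal_le_ofReal ?_
  have := Real.log_le_sub_one_of_pos (div_pos ha1 hb1)
  rw [Real.log_div ha1.ne' hb1.ne'] at this
  linarith

variable {X Y : Type*}

theorem loss_eq_negLog_prod {f : X → Y → ℝ≥0∞} (hf : ∀ x y, f x y ≤ 1) {N : ℕ}
    (D : Fin N → X × Y) : loss f D = negLog (∏ i, f (D i).1 (D i).2) :=
  (negLog_prod _ fun _ _ => hf _ _).symm

/-! Conditional probabilities -/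

theorem le_marginal (p : PMF (X × Y)) (x : X) (y : Y) : p (x, y) ≤ (p.map Prod.fst) x := by
  classical
  rw [PMF.map_apply]
  refine le_trans ?_ (ENNReal.le_tsum (x, y))
  simp

theorem marginal_ne_top (p : PMF (X × Y)) (x : X) : (p.map Prod.fst) x ≠ ⊤ := PMF.apply_ne_top _ _

theorem tsum_marginal (p : PMF (X × Y)) (x : X) : ∑' y, p (x, y) = (p.map Prod.fst) x := by
  classical
  rw [PMF.map_apply, ENNReal.tsum_prod (f := fun x' y => if x = x' then p (x', y) else 0),
    tsum_eq_single x (fun x' h => by simp [h.symm])]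
  simp

theorem condProb_le_one (p : PMF (X × Y)) (x : X) (y : Y) : condProb p x y ≤ 1 :=
  ENNReal.div_le_of_le_mul (by simpa using le_marginal p x y)

theorem condProb_ne_zero {p : PMF (X × Y)} {x : X} {y : Y} (h : p (x, y) ≠ 0) :
    condProb p x y ≠ 0 := by
  exact ENNReal.div_ne_zero.2 ⟨h, marginal_ne_top p x⟩

theorem marginal_ne_zero {p : PMF (X × Y)} {x : X} {y : Y} (h : p (x, y) ≠ 0) :
    (p.map Prod.fst) x ≠ 0 :=
  fun h0 => h (le_antisymm (h0 ▸ le_marginal p x y) zero_le)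

theorem marginal_mul_condProb (p : PMF (X × Y)) (x : X) (y : Y) :
    (p.map Prod.fst) x * condProb p x y = p (x, y) := by
  by_cases h : (p.map Prod.fst) x = 0
  · have := le_marginal p x y
    rw [h] at this
    rw [h, zero_mul]
    exact (le_antisymm this zero_le).symm
  · exact ENNReal.mul_div_cancel h (marginal_ne_top p x)

theorem tsum_condProb {p : PMF (X × Y)} {x : X} (h : (p.map Prod.fst) x ≠ 0) :
    ∑' y, condProb p x y = 1 := by
  simp only [condProb, div_eq_mul_inv]
  rw [ENNReal.tsum_mul_right, tsum_marginal, ENNReal.mul_inv_cancel h (marginal_ne_top p x)]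

/-- A conditional distribution is `p(y|x)` as soon as it agrees with it on the support of `p`. -/
theorem isConditional_of_eq_on_support {p : PMF (X × Y)} {q : X → PMF Y}
    (h : ∀ x y, p (x, y) ≠ 0 → q x y = condProb p x y) : IsConditional p q := by
  intro x hx
  -- Off the support `p(y|x) = 0`, so `p(y|x) ≤ q(y|x)` everywhere. Both have total mass one, which
  -- rules out strict inequality.
  have hle : ∀ y, condProb p x y ≤ q x y := fun y => by
    by_cases hy : p (x, y) = 0
    · simp [condProb, hy]
    · exact (h x y hy).ge
  by_contra! hne
  obtain ⟨y, hy⟩ := hne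
  have := ENNReal.tsum_lt_tsum (by rw [tsum_condProb hx]; simp) hle
    (lt_of_le_of_ne (hle y) (Ne.symm hy))
  rw [tsum_condProb hx, PMF.tsum_coe] at this
  exact lt_irrefl _ this

/-- The likelihood ratio `q(y|x) / p(y|x)`. -/
noncomputable def likelihoodRatio (p : PMF (X × Y)) (q : X → PMF Y) (z : X × Y) : ℝ≥0∞ :=
  q z.1 z.2 / condProb p z.1 z.2

/-- Cancelling `p(y|x)` leaves `p(x) q(y|x)`, of total mass one. Equality can fail because the mass
that this puts off the support of `p` is lost. -/
theorem tsum_mul_likelihoodRatio_le_one (p : PMF (X × Y)) (q : X → PMF Y) :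
    ∑' z, p z * likelihoodRatio p q z ≤ 1 := by
  calc ∑' z, p z * likelihoodRatio p q z
      ≤ ∑' z : X × Y, (p.map Prod.fst) z.1 * q z.1 z.2 := by
        refine ENNReal.tsum_le_tsum fun z => ?_
        by_cases hz : p z = 0
        · simp [hz]
        · rw [← marginal_mul_condProb p z.1 z.2, likelihoodRatio, mul_assoc,
            ENNReal.mul_div_cancel (condProb_ne_zero hz)
              (ne_top_of_le_ne_top ENNReal.one_ne_top (condProb_le_one p _ _))]
    _ = 1 := by
        rw [ENNReal.tsum_prod (f := fun x y => (p.map Prod.fst) x * q x y)]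
        simp_rw [ENNReal.tsum_mul_left, PMF.tsum_coe, mul_one, PMF.tsum_coe]

theorem likelihoodRatio_ne_top {p : PMF (X × Y)} (q : X → PMF Y) {z : X × Y} (h : p z ≠ 0) :
    likelihoodRatio p q z ≠ ⊤ :=
  ENNReal.div_ne_top (PMF.apply_ne_top _ _) (condProb_ne_zero h)

/-- Strict AM-GM for `1` and `a`, from `(√a - 1)² > 0`. -/
theorem rpow_half_lt {a : ℝ≥0∞} (ha : a ≠ ⊤) (h1 : a ≠ 1) : a ^ (1 / 2 : ℝ) < (1 + a) / 2 := by
  have hs : a ^ (1 / 2 : ℝ) = ENNReal.ofReal (Real.sqrt a.toReal) := by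
    rw [Real.sqrt_eq_rpow, ← ENNReal.ofReal_rpow_of_nonneg ENNReal.toReal_nonneg (by norm_num),
      ENNReal.ofReal_toReal ha]
  have hr : (1 + a) / 2 = ENNReal.ofReal ((1 + a.toReal) / 2) := by
    rw [ENNReal.ofReal_div_of_pos two_pos, ENNReal.ofReal_add zero_le_one ENNReal.toReal_nonneg,
      ENNReal.ofReal_toReal ha]
    simp
  have h0 : 0 ≤ a.toReal := ENNReal.toReal_nonneg
  have hne : a.toReal ≠ 1 := fun h => h1 (by rw [← ENNReal.ofReal_toReal ha, h]; simp)
  have hsq := Real.sq_sqrt h0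
  rw [hs, hr]
  refine (ENNReal.ofReal_lt_ofReal_iff (by positivity)).2 ?_
  have : Real.sqrt a.toReal - 1 ≠ 0 := fun h => hne (by
    rw [← hsq, sub_eq_zero.1 h]
    norm_num)
  have := pow_two_pos_of_ne_zero this
  nlinarith

theorem rpow_half_le {a : ℝ≥0∞} (ha : a ≠ ⊤) : a ^ (1 / 2 : ℝ) ≤ (1 + a) / 2 := by
  by_cases h1 : a = 1
  · rw [h1, one_add_one_eq_two, ENNReal.div_self two_ne_zero (by simp)]
    simp
  · exact (rpow_half_lt ha h1).le

/-- The Bhattacharyya coefficient of two different distributions is less than one. -/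
theorem tsum_mul_sqrt_likelihoodRatio_lt_one {p : PMF (X × Y)} {q : X → PMF Y}
    (h : ¬ IsConditional p q) :
    ∑' z, p z * likelihoodRatio p q z ^ (1 / 2 : ℝ) < 1 := by
  obtain ⟨z, hz, hne⟩ : ∃ z : X × Y, p z ≠ 0 ∧ q z.1 z.2 ≠ condProb p z.1 z.2 := by
    by_contra! hall
    exact h (isConditional_of_eq_on_support fun x y hxy => hall (x, y) hxy)
  have hbound : ∑' z, p z * ((1 + likelihoodRatio p q z) / 2) ≤ 1 := by
    calc ∑' z, p z * ((1 + likelihoodRatio p q z) / 2)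
        = (∑' z, (p z + p z * likelihoodRatio p q z)) / 2 := by
          rw [div_eq_mul_inv, ← ENNReal.tsum_mul_right]
          exact tsum_congr fun z => by rw [div_eq_mul_inv, ← mul_assoc, mul_add, mul_one]
      _ ≤ (1 + 1) / 2 := by
          rw [ENNReal.tsum_add, PMF.tsum_coe]
          gcongr
          exact tsum_mul_likelihoodRatio_le_one p q
      _ = 1 := by rw [one_add_one_eq_two, ENNReal.div_self two_ne_zero (by simp)]
  have hle : ∀ z, p z * likelihoodRatio p q z ^ (1 / 2 : ℝ)
      ≤ p z * ((1 + likelihoodRatio p q z) / 2) := fun z => by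
    by_cases hz : p z = 0
    · simp [hz]
    · exact mul_le_mul_right (rpow_half_le (likelihoodRatio_ne_top q hz)) _
  refine lt_of_lt_of_le (ENNReal.tsum_lt_tsum (i := z) ?_ hle ?_) hbound
  · exact ne_top_of_le_ne_top ENNReal.one_ne_top ((ENNReal.tsum_le_tsum hle).trans hbound)
  · refine ENNReal.mul_lt_mul_right hz (PMF.apply_ne_top _ _)
      (rpow_half_lt (likelihoodRatio_ne_top q hz) fun h1 => hne ?_)
    rwa [likelihoodRatio, ENNReal.div_eq_one_iff (condProb_ne_zero hz)
      (ne_top_of_le_ne_top ENNReal.one_ne_top (condProb_le_one p _ _))] at h1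

end

/-! Algorithms for conditional distributions -/

/-- At every precision both values lie within `2 ^ (-n)` of the same output. Thus an algorithm
determines its distribution, and distributions can be indexed by algorithms. -/
theorem Computes.unique {X Y : Type*} [Primcodable X] [Primcodable Y] {c : Nat.Partrec.Code}
    {q q' : X → PMF Y} (h : Computes c q) (h' : Computes c q') : q = q' := by
  funext x
  ext y
  rw [← ENNReal.toReal_eq_toReal_iff' (PMF.apply_ne_top _ _) (PMF.apply_ne_top _ _)]
  have hle : ∀ n : ℕ, |(q x y).toReal - (q' x y).toReal| ≤ 2 * (1 / 2) ^ n := fun n => by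
    obtain ⟨m, hm, hq⟩ := h x y n
    obtain ⟨m', hm', hq'⟩ := h' x y n
    obtain rfl := Part.mem_unique hm hm'
    rw [abs_sub_comm] at hq'
    have := abs_sub_le (q x y).toReal ((m : ℝ) / 2 ^ n) (q' x y).toReal
    rw [one_div_pow]
    linarith
  have hlim : Filter.Tendsto (fun n : ℕ => 2 * (1 / 2 : ℝ) ^ n) Filter.atTop (nhds (2 * 0)) :=
    (tendsto_pow_atTop_nhds_zero_of_lt_one (by norm_num) (by norm_num)).const_mul 2
  rw [mul_zero] at hlim
  have := ge_of_tendsto' hlim hle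
  exact sub_eq_zero.1 (abs_nonpos_iff.1 this)

/-- The algorithms that compute some conditional distribution. -/
def Algorithm (X Y : Type*) [Primcodable X] [Primcodable Y] : Type :=
  {c : Nat.Partrec.Code // ∃ q : X → PMF Y, Computes c q}

noncomputable section

namespace Algorithm

variable {X Y : Type*} [Primcodable X] [Primcodable Y]

instance : Countable (Algorithm X Y) := inferInstanceAs (Countable {_c : Nat.Partrec.Code // _})

/-- The conditional distribution computed by an algorithm. -/
def dist (i : Algorithm X Y) : X → PMF Y := i.2.choose

theorem computes_dist (i : Algorithm X Y) : Computes i.1 i.dist := i.2.choose_spec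

theorem isComputable_dist (i : Algorithm X Y) : IsComputable i.dist := ⟨i.1, i.computes_dist⟩

/-- The length of a shortest program for an algorithm. -/
def length (U : List Bool →. ℕ) (i : Algorithm X Y) : ℕ :=
  (programLength U (Encodable.encode i.1)).toNat

/-- The prior probability `2 ^ (-length)` of an algorithm. -/
def weight (U : List Bool →. ℕ) (i : Algorithm X Y) : ℝ≥0∞ := 2⁻¹ ^ i.length U

variable {U : List Bool →. ℕ}

theorem weight_ne_zero (i : Algorithm X Y) : i.weight U ≠ 0 := by simp [weight]

theorem weight_le_one (i : Algorithm X Y) : i.weight U ≤ 1 :=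
  pow_le_one₀ zero_le (by simp)

theorem weight_ne_top (i : Algorithm X Y) : i.weight U ≠ ⊤ :=
  ne_top_of_le_ne_top ENNReal.one_ne_top i.weight_le_one

theorem tsum_weight_le_one (hU : IsUniversalPrefixMachine U) :
    ∑' i : Algorithm X Y, i.weight U ≤ 1 := by
  have hinj : Function.Injective fun i : Algorithm X Y => Encodable.encode i.1 :=
    Encodable.encode_injective.comp Subtype.val_injective
  exact (ENNReal.tsum_comp_le_tsum_of_injective hinj
    fun n => (2⁻¹ : ℝ≥0∞) ^ (programLength U n).toNat).trans hU.tsum_two_inv_pow_le_one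

theorem negLog_weight (hU : IsUniversalPrefixMachine U) (i : Algorithm X Y) :
    negLog (i.weight U)
      = (programLength U (Encodable.encode i.1) : ℝ≥0∞) * ENNReal.ofReal (Real.log 2) := by
  rw [weight, negLog_two_inv_pow, length]
  conv_rhs => rw [← ENat.natCast_toNat (hU.programLength_ne_top (Encodable.encode i.1))]
  simp

theorem negLog_weight_le_of_length_le {i j : Algorithm X Y} (h : i.length U ≤ j.length U) :
    negLog (i.weight U) ≤ negLog (j.weight U) := by
  rw [weight, weight, negLog_two_inv_pow, negLog_two_inv_pow]
  gcongr

theorem complexity_le (hU : IsUniversalPrefixMachine U) (i : Algorithm X Y) :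
    complexity U i.dist ≤ negLog (i.weight U) := by
  rw [negLog_weight hU]
  exact iInf₂_le i.1 i.computes_dist

/-- The complexity of a computable conditional distribution is attained. -/
theorem exists_dist_eq (hU : IsUniversalPrefixMachine U) {q : X → PMF Y} (hq : IsComputable q) :
    ∃ i : Algorithm X Y, i.dist = q ∧ complexity U q = negLog (i.weight U) := by
  obtain ⟨c, hc⟩ := hq
  have hne : {i : Algorithm X Y | i.dist = q}.Nonempty :=
    ⟨⟨c, q, hc⟩, (computes_dist (⟨c, q, hc⟩ : Algorithm X Y)).unique hc⟩
  obtain ⟨i, hi, hmin⟩ := (wellFounded_lt.onFun (f := length U)).has_min _ hne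
  refine ⟨i, hi, le_antisymm (hi ▸ i.complexity_le hU) ?_⟩
  refine le_iInf₂ fun d hd => ?_
  let j : Algorithm X Y := ⟨d, q, hd⟩
  rw [← negLog_weight hU j]
  exact negLog_weight_le_of_length_le (not_lt.1 (hmin j (j.computes_dist.unique hd)))

/-- Passing from distributions to algorithms makes the index set countable with summable weights.
Longer algorithms for the same distribution do not change the infimum. -/
theorem taskComplexity_eq_iInf (hU : IsUniversalPrefixMachine U) {N : ℕ} (D : Fin N → X × Y) :
    taskComplexity U D
      = ⨅ i : Algorithm X Y, loss (fun x y => i.dist x y) D + negLog (i.weight U) := by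
  refine le_antisymm (le_iInf fun i => ?_) (le_iInf₂ fun q hq => ?_)
  · exact (iInf₂_le i.dist i.isComputable_dist).trans (add_le_add le_rfl (i.complexity_le hU))
  · obtain ⟨i, rfl, hi⟩ := exists_dist_eq hU hq
    rw [hi]
    exact iInf_le _ i

/-- The complexity of `p(y|x)` is attained. -/
theorem exists_conditionalComplexity_eq (hU : IsUniversalPrefixMachine U) {p : PMF (X × Y)}
    (hp : HasComputableConditional p) :
    ∃ i : Algorithm X Y, IsConditional p i.dist ∧
      conditionalComplexity U p = negLog (i.weight U) := by
  obtain ⟨q, hq, hqp⟩ := hp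
  have hne : {i : Algorithm X Y | IsConditional p i.dist}.Nonempty := by
    obtain ⟨i, rfl, -⟩ := exists_dist_eq hU hq
    exact ⟨i, hqp⟩
  obtain ⟨i, hi, hmin⟩ := (wellFounded_lt.onFun (f := length U)).has_min _ hne
  refine ⟨i, hi, le_antisymm ?_ ?_⟩
  · exact (iInf₂_le i.dist i.isComputable_dist).trans
      ((iInf_le _ hi).trans (i.complexity_le hU))
  · refine le_iInf₂ fun q' hq' => le_iInf fun hq'p => ?_
    obtain ⟨j, rfl, hj⟩ := exists_dist_eq hU hq'
    rw [hj]
    exact negLog_weight_le_of_length_le (not_lt.1 (hmin j hq'p))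

end Algorithm

/-! Comparison of losses on a dataset in the support of `p` -/

variable {X Y : Type*} {p : PMF (X × Y)} {N : ℕ} {D : Fin N → X × Y}

theorem prod_condProb_ne_zero (hD : ∀ k, p (D k) ≠ 0) :
    ∏ k, condProb p (D k).1 (D k).2 ≠ 0 :=
  Finset.prod_ne_zero_iff.2 fun k _ => condProb_ne_zero (hD k)

theorem loss_condProb_ne_top (hD : ∀ k, p (D k) ≠ 0) : loss (condProb p) D ≠ ⊤ := by
  rw [loss_eq_negLog_prod (condProb_le_one p)]
  exact negLog_ne_top (prod_condProb_ne_zero hD)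

theorem IsConditional.loss_eq {q : X → PMF Y} (hq : IsConditional p q) (hD : ∀ k, p (D k) ≠ 0) :
    loss (fun x y => q x y) D = loss (condProb p) D :=
  Finset.sum_congr rfl fun k _ => congrArg negLog (hq _ (marginal_ne_zero (hD k)) _)

theorem prod_condProb_le_one : ∏ k, condProb p (D k).1 (D k).2 ≤ 1 :=
  Finset.prod_le_one' fun _ _ => condProb_le_one p _ _

theorem loss_add_negLog (q : X → PMF Y) {w : ℝ≥0∞} (hw : w ≤ 1) :
    loss (fun x y => q x y) D + negLog w = negLog (w * ∏ k, q (D k).1 (D k).2) := by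
  rw [loss_eq_negLog_prod fun x y => PMF.coe_le_one _ _,
    negLog_mul hw (Finset.prod_le_one' fun _ _ => PMF.coe_le_one _ _), add_comm]

theorem prod_likelihoodRatio_mul (q : X → PMF Y) (hD : ∀ k, p (D k) ≠ 0) :
    (∏ k, likelihoodRatio p q (D k)) * ∏ k, condProb p (D k).1 (D k).2
      = ∏ k, q (D k).1 (D k).2 := by
  rw [← Finset.prod_mul_distrib]
  refine Finset.prod_congr rfl fun k _ => ?_
  exact ENNReal.div_mul_cancel (condProb_ne_zero (hD k))
    (ne_top_of_le_ne_top ENNReal.one_ne_top (condProb_le_one p _ _))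

/-- `negLog_add_one_le` with `a = w ∏ q(y|x)` and `b = ∏ p(y|x)`, which is nonzero on the support of
`p`. -/
theorem loss_condProb_add_one_le (q : X → PMF Y) {w : ℝ≥0∞} (hw : w ≤ 1)
    (hD : ∀ k, p (D k) ≠ 0) :
    loss (condProb p) D + 1
      ≤ loss (fun x y => q x y) D + negLog w + w * ∏ k, likelihoodRatio p q (D k) := by
  have h := negLog_add_one_le (a := w * ∏ k, q (D k).1 (D k).2)
    (mul_le_one' hw (Finset.prod_le_one' fun _ _ => PMF.coe_le_one _ _))
    (prod_condProb_le_one (D := D)) (prod_condProb_ne_zero hD)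
  rwa [← loss_eq_negLog_prod (condProb_le_one p), ← loss_add_negLog q hw,
    ← prod_likelihoodRatio_mul q hD, ← mul_assoc,
    ENNReal.mul_div_cancel_right (prod_condProb_ne_zero hD)
      (ne_top_of_le_ne_top ENNReal.one_ne_top prod_condProb_le_one)] at h

theorem loss_condProb_add_negLog_lt (q : X → PMF Y) {v w : ℝ≥0∞} (hv : v ≤ 1) (hw : w ≤ 1)
    (hD : ∀ k, p (D k) ≠ 0) (h : w * ∏ k, likelihoodRatio p q (D k) < v) :
    loss (condProb p) D + negLog v < loss (fun x y => q x y) D + negLog w := by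
  rw [loss_add_negLog q hw, loss_eq_negLog_prod (condProb_le_one p), add_comm,
    ← negLog_mul hv prod_condProb_le_one, ← prod_likelihoodRatio_mul q hD, ← mul_assoc]
  exact negLog_lt_negLog (ENNReal.mul_lt_mul_left (prod_condProb_ne_zero hD)
    (ne_top_of_le_ne_top ENNReal.one_ne_top prod_condProb_le_one) h)
    (mul_le_one' hv prod_condProb_le_one)

variable [Primcodable X] [Primcodable Y] {U : List Bool →. ℕ}

/-- Each weighted ratio is at most the whole mixture. The latter does not depend on `i`, so it
survives the infimum. -/
theorem loss_condProb_add_one_le_taskComplexity (hU : IsUniversalPrefixMachine U)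
    (hD : ∀ k, p (D k) ≠ 0) :
    loss (condProb p) D + 1 ≤ taskComplexity U D
      + ∑' i : Algorithm X Y, i.weight U * ∏ k, likelihoodRatio p i.dist (D k) := by
  rw [Algorithm.taskComplexity_eq_iInf hU, ENNReal.iInf_add]
  exact le_iInf fun i => (loss_condProb_add_one_le i.dist i.weight_le_one hD).trans
    (add_le_add le_rfl (ENNReal.le_tsum i))

theorem taskComplexity_le (hU : IsUniversalPrefixMachine U) (hp : HasComputableConditional p)
    (hD : ∀ k, p (D k) ≠ 0) :
    taskComplexity U D ≤ loss (condProb p) D + conditionalComplexity U p := by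
  obtain ⟨i, hi, hK⟩ := Algorithm.exists_conditionalComplexity_eq hU hp
  rw [hK, ← hi.loss_eq hD, Algorithm.taskComplexity_eq_iInf hU]
  exact iInf_le _ i

/-- If no algorithm for a distribution other than `p(y|x)` beats the shortest one for `p(y|x)`,
then the minimum defining the task complexity is attained exactly at `p(y|x)`. -/
theorem taskComplexity_eq_and_minimizer_iff (hU : IsUniversalPrefixMachine U)
    (hp : HasComputableConditional p) (hD : ∀ k, p (D k) ≠ 0)
    (hlt : ∀ i : Algorithm X Y, ¬ IsConditional p i.dist →
      loss (condProb p) D + conditionalComplexity U p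
        < loss (fun x y => i.dist x y) D + negLog (i.weight U)) :
    taskComplexity U D = loss (condProb p) D + conditionalComplexity U p ∧
    ∀ q : X → PMF Y, IsComputable q →
      (taskComplexity U D = loss (fun x y => q x y) D + complexity U q
        ↔ IsConditional p q ∧ complexity U q = conditionalComplexity U p) := by
  have heq : taskComplexity U D = loss (condProb p) D + conditionalComplexity U p := by
    refine le_antisymm (taskComplexity_le hU hp hD) (le_iInf₂ fun q hq => ?_)
    by_cases hc : IsConditional p q
    · rw [hc.loss_eq hD]
      exact add_le_add le_rfl (iInf₂_le_of_le q hq (iInf_le _ hc))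
    · obtain ⟨i, rfl, hi⟩ := Algorithm.exists_dist_eq hU hq
      rw [hi]
      exact (hlt i hc).le
  refine ⟨heq, fun q hq => ⟨fun h => ?_, fun ⟨hc, hK⟩ => by rw [heq, hc.loss_eq hD, hK]⟩⟩
  by_cases hc : IsConditional p q
  · refine ⟨hc, ?_⟩
    rw [heq, hc.loss_eq hD] at h
    exact ((ENNReal.add_right_inj (loss_condProb_ne_top hD)).1 h).symm
  · obtain ⟨i, rfl, hi⟩ := Algorithm.exists_dist_eq hU hq
    rw [heq, hi] at h
    exact absurd h (hlt i hc).ne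

theorem taskComplexity_deviation {N : ℕ} {D : Fin N → X × Y} {H δ : ℝ≥0∞}
    (h : taskComplexity U D = loss (condProb p) D + conditionalComplexity U p)
    (hdev : loss (condProb p) D ≤ H + δ ∧ H ≤ loss (condProb p) D + δ) :
    taskComplexity U D ≤ H + conditionalComplexity U p + δ ∧
      H + conditionalComplexity U p ≤ taskComplexity U D + δ := by
  rw [h, add_right_comm H, add_right_comm (loss _ _)]
  exact ⟨add_le_add hdev.1 le_rfl, add_le_add hdev.2 le_rfl⟩

end

/-! Products of independent nonnegative random variables -/

section

open Filter Topology

variable {Ω : Type*} {m : MeasurableSpace Ω} {μ : Measure Ω}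

/-- Ville's inequality: the supermartingale property is only needed on the event that the level
has not been reached. -/
theorem mul_measure_exists_le_le {S : ℕ → Ω → ℝ≥0∞} (hS : ∀ n, Measurable (S n)) (a : ℝ≥0∞)
    (hsuper : ∀ n, ∫⁻ ω in {ω | ∀ k ≤ n, S k ω < a}, S (n + 1) ω ∂μ
      ≤ ∫⁻ ω in {ω | ∀ k ≤ n, S k ω < a}, S n ω ∂μ) :
    a * μ {ω | ∃ n, a ≤ S n ω} ≤ ∫⁻ ω, S 0 ω ∂μ := by
  have hlt : ∀ n, MeasurableSet {ω | S n ω < a} := fun n => measurableSet_lt (hS n) measurable_const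
  -- Stopping at the first passage: paths that have reached level `a` are counted with value `a`,
  -- the others with their current value. This total never exceeds the initial mean.
  have hfin : ∀ n, a * μ {ω | ∃ k ≤ n, a ≤ S k ω}
      + ∫⁻ ω in {ω | ∀ k ≤ n, S k ω < a}, S n ω ∂μ ≤ ∫⁻ ω, S 0 ω ∂μ := by
    have hmarkov : ∀ (n : ℕ) (A : Set Ω), a * μ (A \ {ω | S n ω < a})
        ≤ ∫⁻ ω in A \ {ω | S n ω < a}, S n ω ∂μ := fun n A => by
      rw [← setLIntegral_const]
      refine setLIntegral_mono (hS n) fun ω hω => ?_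
      simpa using hω.2
    intro n
    induction n with
    | zero =>
      have h0 : {ω | ∃ k ≤ 0, a ≤ S k ω} = Set.univ \ {ω | S 0 ω < a} := by ext; simp
      have h1 : {ω | ∀ k ≤ 0, S k ω < a} = Set.univ ∩ {ω | S 0 ω < a} := by ext; simp
      rw [h0, h1]
      refine (add_le_add (hmarkov 0 _) le_rfl).trans ?_
      rw [add_comm, lintegral_inter_add_sdiff _ _ (hlt 0), setLIntegral_univ]
    | succ n ih =>
      set B := {ω | ∀ k ≤ n, S k ω < a} with hB
      have h0 : {ω | ∃ k ≤ n + 1, a ≤ S k ω}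
          = {ω | ∃ k ≤ n, a ≤ S k ω} ∪ (B \ {ω | S (n + 1) ω < a}) := by
        ext ω
        simp only [Set.mem_ofPred_eq, Set.mem_union, Set.mem_sdiff, hB, not_lt]
        constructor
        · rintro ⟨k, hk, hka⟩
          by_cases h : ∃ k ≤ n, a ≤ S k ω
          · exact Or.inl h
          · push Not at h
            rcases Nat.le_succ_iff.1 hk with hk | rfl
            · exact absurd (h k hk) (not_lt.2 hka)
            · exact Or.inr ⟨h, hka⟩
        · rintro (⟨k, hk, hka⟩ | ⟨-, h⟩)
          · exact ⟨k, hk.trans n.le_succ, hka⟩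
          · exact ⟨n + 1, le_rfl, h⟩
      have h1 : {ω | ∀ k ≤ n + 1, S k ω < a} = B ∩ {ω | S (n + 1) ω < a} := by
        ext ω
        simp only [hB, Set.mem_ofPred_eq, Set.mem_inter_iff]
        exact ⟨fun h => ⟨fun k hk => h k (hk.trans n.le_succ), h _ le_rfl⟩,
          fun h k hk => (Nat.le_succ_iff.1 hk).elim (h.1 k) fun e => e ▸ h.2⟩
      calc a * μ {ω | ∃ k ≤ n + 1, a ≤ S k ω}
            + ∫⁻ ω in {ω | ∀ k ≤ n + 1, S k ω < a}, S (n + 1) ω ∂μ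
          ≤ (a * μ {ω | ∃ k ≤ n, a ≤ S k ω} + a * μ (B \ {ω | S (n + 1) ω < a}))
            + ∫⁻ ω in B ∩ {ω | S (n + 1) ω < a}, S (n + 1) ω ∂μ := by
            rw [h0, h1, ← mul_add]
            gcongr
            exact measure_union_le _ _
        _ ≤ a * μ {ω | ∃ k ≤ n, a ≤ S k ω}
            + (∫⁻ ω in B ∩ {ω | S (n + 1) ω < a}, S (n + 1) ω ∂μ
              + ∫⁻ ω in B \ {ω | S (n + 1) ω < a}, S (n + 1) ω ∂μ) := by
            rw [add_assoc, add_comm (a * μ (B \ _))]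
            gcongr
            exact hmarkov (n + 1) B
        _ ≤ a * μ {ω | ∃ k ≤ n, a ≤ S k ω} + ∫⁻ ω in B, S n ω ∂μ := by
            rw [lintegral_inter_add_sdiff _ _ (hlt (n + 1))]
            exact add_le_add le_rfl (hsuper n)
        _ ≤ ∫⁻ ω, S 0 ω ∂μ := ih
  have hunion : {ω | ∃ n, a ≤ S n ω} = ⋃ n, {ω | ∃ k ≤ n, a ≤ S k ω} := by
    ext ω
    simp only [Set.mem_ofPred_eq, Set.mem_iUnion]
    exact ⟨fun ⟨n, hn⟩ => ⟨n, n, le_rfl, hn⟩, fun ⟨_, k, _, hk⟩ => ⟨k, hk⟩⟩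
  have hmono : Monotone fun n => {ω | ∃ k ≤ n, a ≤ S k ω} :=
    fun n n' h ω ⟨k, hk, hka⟩ => ⟨k, hk.trans h, hka⟩
  rw [hunion, hmono.measure_iUnion, ENNReal.mul_iSup]
  exact iSup_le fun n => le_self_add.trans (hfin n)

variable {α : Type*} [MeasurableSpace α] {Z : ℕ → Ω → α}

/-- The `σ`-algebra of the first `n` samples. -/
abbrev pastSigma (Z : ℕ → Ω → α) (n : ℕ) : MeasurableSpace Ω :=
  ⨆ k ∈ Set.Iio n, MeasurableSpace.comap (Z k) inferInstance

theorem pastSigma_le (hmeas : ∀ k, Measurable (Z k)) (n : ℕ) : pastSigma Z n ≤ m :=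
  iSup₂_le fun k _ => (hmeas k).comap_le

theorem measurable_pastSigma {n k : ℕ} (h : k < n) : Measurable[pastSigma Z n] (Z k) :=
  (comap_measurable (Z k)).mono
    (le_iSup₂ (f := fun k (_ : k ∈ Set.Iio n) => MeasurableSpace.comap (Z k) inferInstance) k h)
    le_rfl

theorem lintegral_mul_next (hmeas : ∀ k, Measurable (Z k)) (hindep : iIndepFun Z μ) {n : ℕ}
    {f : Ω → ℝ≥0∞} (hf : Measurable[pastSigma Z n] f) {g : α → ℝ≥0∞} (hg : Measurable g) :
    ∫⁻ ω, f ω * g (Z n ω) ∂μ = (∫⁻ ω, f ω ∂μ) * ∫⁻ ω, g (Z n ω) ∂μ := by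
  have hi : Indep (pastSigma Z n) (MeasurableSpace.comap (Z n) inferInstance) μ := by
    have := indep_iSup_of_disjoint (fun k => (hmeas k).comap_le) hindep
      (S := Set.Iio n) (T := {n}) (by simp)
    simpa [pastSigma] using this
  exact lintegral_mul_eq_lintegral_mul_lintegral_of_independent_measurableSpace
    (pastSigma_le hmeas n) (hmeas n).comap_le hi hf
    (hg.comp (comap_measurable (Z n)))

variable {ι : Type*} [Countable ι] {w : ι → ℝ≥0∞} {r : ι → α → ℝ≥0∞}

theorem measurable_tsum_ennreal {β : Type*} {_ : MeasurableSpace β} {f : ι → β → ℝ≥0∞}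
    (hf : ∀ i, Measurable (f i)) : Measurable fun b => ∑' i, f i b :=
  Measurable.tsum hf

theorem measurable_tsum_mul_prod (hr : ∀ i, Measurable (r i)) {n k : ℕ} (h : k ≤ n) :
    Measurable[pastSigma Z n] fun ω => ∑' i, w i * ∏ j ∈ Finset.range k, r i (Z j ω) := by
  refine measurable_tsum_ennreal fun i => Measurable.const_mul ?_ _
  exact Finset.measurable_prod _ fun j hj =>
    (hr i).comp (measurable_pastSigma ((Finset.mem_range.1 hj).trans_le h))

/-- A mixture of products of independent likelihood ratios rarely becomes large. -/
theorem mul_measure_exists_le_tsum_le [IsProbabilityMeasure μ] (hmeas : ∀ k, Measurable (Z k))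
    (hindep : iIndepFun Z μ) (hr : ∀ i, Measurable (r i))
    (hone : ∀ i k, ∫⁻ ω, r i (Z k ω) ∂μ ≤ 1) (a : ℝ≥0∞) :
    a * μ {ω | ∃ n, a ≤ ∑' i, w i * ∏ j ∈ Finset.range n, r i (Z j ω)} ≤ ∑' i, w i := by
  have hS : ∀ n, Measurable fun ω => ∑' i, w i * ∏ j ∈ Finset.range n, r i (Z j ω) :=
    fun n => (measurable_tsum_mul_prod hr le_rfl).mono (pastSigma_le hmeas n) le_rfl
  refine (mul_measure_exists_le_le hS a fun n => ?_).trans (by simp)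
  set B := {ω | ∀ k ≤ n, ∑' i, w i * ∏ j ∈ Finset.range k, r i (Z j ω) < a} with hBdef
  have hB : MeasurableSet[pastSigma Z n] B := by
    have : B = ⋂ k, ⋂ (_ : k ≤ n), {ω | ∑' i, w i * ∏ j ∈ Finset.range k, r i (Z j ω) < a} := by
      ext ω
      simp [hBdef]
    rw [this]
    exact MeasurableSet.iInter fun k => MeasurableSet.iInter fun hk =>
      measurable_tsum_mul_prod hr hk measurableSet_Iio
  have hB' : MeasurableSet B := pastSigma_le hmeas n _ hB
  have hprod : ∀ (i : ι) (n : ℕ), Measurable fun ω => ∏ j ∈ Finset.range n, r i (Z j ω) :=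
    fun i n => Finset.measurable_prod _ fun j _ => (hr i).comp (hmeas j)
  rw [lintegral_tsum fun i => ((hprod i _).const_mul _).aemeasurable,
    lintegral_tsum fun i => ((hprod i _).const_mul _).aemeasurable]
  refine ENNReal.tsum_le_tsum fun i => ?_
  rw [lintegral_const_mul _ (hprod i _), lintegral_const_mul _ (hprod i _)]
  refine mul_le_mul_right ?_ _
  rw [← lintegral_indicator hB', ← lintegral_indicator hB']
  -- `B` and the product depend only on the first `n` samples, so the factor at sample `n` is
  -- independent of them and has mean at most one.
  have hind : Measurable[pastSigma Z n]
      (B.indicator fun ω => ∏ j ∈ Finset.range n, r i (Z j ω)) :=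
    Measurable.indicator (Finset.measurable_prod _ fun j hj =>
      (hr i).comp (measurable_pastSigma (Finset.mem_range.1 hj))) hB
  calc ∫⁻ ω, B.indicator (fun ω => ∏ j ∈ Finset.range (n + 1), r i (Z j ω)) ω ∂μ
      = ∫⁻ ω, B.indicator (fun ω => ∏ j ∈ Finset.range n, r i (Z j ω)) ω * r i (Z n ω) ∂μ := by
        refine lintegral_congr fun ω => ?_
        by_cases hω : ω ∈ B <;> simp [hω, Finset.prod_range_succ]
    _ ≤ ∫⁻ ω, B.indicator (fun ω => ∏ j ∈ Finset.range n, r i (Z j ω)) ω ∂μ := by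
        rw [lintegral_mul_next hmeas hindep hind (hr i)]
        exact mul_le_of_le_one_right zero_le (hone i n)

/-- The mean of a mixture of products of independent likelihood ratios. -/
theorem lintegral_tsum_mul_prod_le (hmeas : ∀ k, Measurable (Z k))
    (hindep : iIndepFun Z μ) (hr : ∀ i, Measurable (r i))
    (hone : ∀ i k, ∫⁻ ω, r i (Z k ω) ∂μ ≤ 1) (n : ℕ) :
    ∫⁻ ω, ∑' i, w i * ∏ j ∈ Finset.range n, r i (Z j ω) ∂μ ≤ ∑' i, w i := by
  have hprod : ∀ i, Measurable fun ω => ∏ j ∈ Finset.range n, r i (Z j ω) :=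
    fun i => Finset.measurable_prod _ fun j _ => (hr i).comp (hmeas j)
  rw [lintegral_tsum fun i => ((hprod i).const_mul _).aemeasurable]
  refine ENNReal.tsum_le_tsum fun i => ?_
  rw [lintegral_const_mul _ (hprod i), lintegral_prod_eq_prod_lintegral_of_indepFun _
    (fun j ω => r i (Z j ω)) (hindep.comp (fun _ => r i) fun _ => hr i)
    fun j => (hr i).comp (hmeas j)]
  exact mul_le_of_le_one_right zero_le (Finset.prod_le_one' fun j _ => hone i j)

/-- The square root of the `n`-th product has mean at most `ρ ^ n` by independence. These means are
summable, so almost surely the square roots form a convergent series and tend to zero; squaring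
finishes. -/
theorem ae_tendsto_prod_zero (hmeas : ∀ k, Measurable (Z k)) (hindep : iIndepFun Z μ)
    {g : α → ℝ≥0∞} (hg : Measurable g) {ρ : ℝ≥0∞} (hρ : ρ < 1)
    (hsqrt : ∀ k, ∫⁻ ω, g (Z k ω) ^ (1 / 2 : ℝ) ∂μ ≤ ρ) :
    ∀ᵐ ω ∂μ, Tendsto (fun n => ∏ j ∈ Finset.range n, g (Z j ω)) atTop (𝓝 0) := by
  have hm : ∀ j, Measurable fun ω => g (Z j ω) ^ (1 / 2 : ℝ) :=
    fun j => (hg.comp (hmeas j)).pow_const _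
  have hprod : ∀ n, Measurable fun ω => ∏ j ∈ Finset.range n, g (Z j ω) ^ (1 / 2 : ℝ) :=
    fun n => Finset.measurable_prod _ fun j _ => hm j
  have hsum : ∫⁻ ω, ∑' n, ∏ j ∈ Finset.range n, g (Z j ω) ^ (1 / 2 : ℝ) ∂μ ≠ ⊤ := by
    rw [lintegral_tsum fun n => (hprod n).aemeasurable]
    refine ne_top_of_le_ne_top (b := ∑' n : ℕ, ρ ^ n) ?_ (ENNReal.tsum_le_tsum fun n => ?_)
    · rw [ENNReal.tsum_geometric]
      exact ENNReal.inv_ne_top.2 (tsub_pos_of_lt hρ).ne'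
    · rw [lintegral_prod_eq_prod_lintegral_of_indepFun _
        (fun j ω => g (Z j ω) ^ (1 / 2 : ℝ))
        (hindep.comp (fun _ z => g z ^ (1 / 2 : ℝ)) fun _ => hg.pow_const _) hm]
      exact (Finset.prod_le_prod' fun j _ => hsqrt j).trans (by simp)
  filter_upwards [ae_lt_top (Measurable.tsum hprod) hsum] with ω hω
  have hlim := (ENNReal.tendsto_atTop_zero_of_tsum_ne_top hω.ne).ennrpow_const (2 : ℝ)
  rw [ENNReal.zero_rpow_of_pos two_pos] at hlim
  refine hlim.congr fun n => ?_
  rw [ENNReal.prod_rpow_of_nonneg (by norm_num), ← ENNReal.rpow_mul]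
  norm_num

/-- The limits in `hzero` are not uniform in `i`. They are used on a random finite set `F` only;
outside `F` the mixture stays below `a` for all `n`. -/
theorem ae_eventually_forall_mul_prod_lt [IsProbabilityMeasure μ] (hmeas : ∀ k, Measurable (Z k))
    (hindep : iIndepFun Z μ) (hr : ∀ i, Measurable (r i))
    (hone : ∀ i k, ∫⁻ ω, r i (Z k ω) ∂μ ≤ 1) (hw : ∑' i, w i ≠ ⊤) {a : ℝ≥0∞} (ha : a ≠ 0)
    (ha' : a ≠ ⊤)
    (hzero : ∀ i, ∀ᵐ ω ∂μ, Tendsto (fun n => ∏ j ∈ Finset.range n, r i (Z j ω)) atTop (𝓝 0)) :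
    ∀ᵐ ω ∂μ, ∀ᶠ n in atTop, ∀ i, w i * ∏ j ∈ Finset.range n, r i (Z j ω) < a := by
  have htail : ∀ᵐ ω ∂μ, ∃ F : Finset ι, ∀ n,
      ∑' i : {i // i ∉ F}, w i * ∏ j ∈ Finset.range n, r i (Z j ω) < a := by
    rw [ae_iff]
    push Not
    -- The event that every `F` fails lies in the failure event of each single `F`, which Ville's
    -- inequality bounds by the tail weight over `a`. The tail vanishes as `F` grows.
    have hle : ∀ F : Finset ι, μ {ω | ∀ F : Finset ι, ∃ n,
        a ≤ ∑' i : {i // i ∉ F}, w i * ∏ j ∈ Finset.range n, r i (Z j ω)}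
        ≤ (∑' i : {i // i ∉ F}, w i) / a := fun F => by
      rw [ENNReal.le_div_iff_mul_le (Or.inl ha) (Or.inl ha'), mul_comm]
      refine le_trans (mul_le_mul_right (measure_mono fun ω hω => ?_) _)
        (mul_measure_exists_le_tsum_le (w := fun i : {i // i ∉ F} => w i)
          (r := fun i : {i // i ∉ F} => r i) hmeas hindep (fun i => hr i) (fun i => hone i) a)
      exact hω F
    have hlim := ENNReal.Tendsto.div_const (ENNReal.tendsto_tsum_compl_atTop_zero hw)
      (b := a) (Or.inr ha)
    rw [ENNReal.zero_div] at hlim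
    exact le_antisymm (ge_of_tendsto' hlim hle) zero_le
  filter_upwards [htail, ae_all_iff.2 hzero] with ω ⟨F, hF⟩ hz
  have hfin : ∀ᶠ n in atTop, ∀ i ∈ F, w i * ∏ j ∈ Finset.range n, r i (Z j ω) < a := by
    refine (Filter.eventually_all_finset F).2 fun i _ => ?_
    have hlim := ENNReal.Tendsto.const_mul (hz i) (a := w i)
      (Or.inr (ne_top_of_le_ne_top hw (ENNReal.le_tsum i)))
    rw [mul_zero] at hlim
    exact hlim.eventually_lt_const (pos_iff_ne_zero.2 ha)
  filter_upwards [hfin] with n hn i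
  by_cases hi : i ∈ F
  · exact hn i hi
  · exact (ENNReal.le_tsum (f := fun i : {i // i ∉ F} =>
      w i * ∏ j ∈ Finset.range n, r i (Z j ω)) ⟨i, hi⟩).trans_lt (hF n)

end

section

open Filter Topology

/-! Eventual events and real-valued deviations -/

theorem exists_le_measure_forall_ge {Ω : Type*} [MeasurableSpace Ω] {μ : Measure Ω}
    [IsProbabilityMeasure μ] {P : ℕ → Ω → Prop} (h : ∀ᵐ ω ∂μ, ∀ᶠ n in atTop, P n ω)
    {ε : ℝ} (hε : 0 < ε) :
    ∃ N₀ : ℕ, 1 - ENNReal.ofReal ε ≤ μ {ω | ∀ N : ℕ, N₀ ≤ N → P N ω} := by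
  have hmono : Monotone fun n : ℕ => {ω | ∀ N : ℕ, n ≤ N → P N ω} :=
    fun m n hmn ω hω N hN => hω N (hmn.trans hN)
  have huniv : μ (⋃ n : ℕ, {ω | ∀ N : ℕ, n ≤ N → P N ω}) = 1 := by
    refine (measure_congr (eventuallyEq_univ.2 ?_)).trans measure_univ
    filter_upwards [h] with ω hω
    exact Set.mem_iUnion.2 (eventually_atTop.1 hω)
  have hlim := tendsto_measure_iUnion_atTop (μ := μ) hmono
  rw [huniv] at hlim
  have hlt : 1 - ENNReal.ofReal ε < 1 :=
    ENNReal.sub_lt_self ENNReal.one_ne_top one_ne_zero (by simpa using hε)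
  obtain ⟨n, hn⟩ := (hlim.eventually_const_lt hlt).exists
  exact ⟨n, hn.le⟩

theorem ofReal_le_ofReal_add_of_abs_sub_le {a b δ : ℝ} (h : |a - b| ≤ δ) :
    ENNReal.ofReal a ≤ ENNReal.ofReal b + ENNReal.ofReal δ :=
  (ENNReal.ofReal_le_ofReal (by linarith [(abs_le.1 h).2])).trans ENNReal.ofReal_add_le

/-- With `s = √t` the left side is `4 (s log s)²`, and `|s log s| < 1`. -/
theorem mul_log_sq_le_four {t : ℝ} (h0 : 0 < t) (h1 : t ≤ 1) : t * Real.log t ^ 2 ≤ 4 := by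
  have hs := Real.abs_log_mul_self_lt (Real.sqrt t) (Real.sqrt_pos.2 h0) (Real.sqrt_le_one.2 h1)
  rw [Real.log_sqrt h0.le] at hs
  have h2 := (sq_lt_one_iff_abs_lt_one _).2 hs
  have h3 := Real.sq_sqrt h0.le
  have : (Real.log t / 2 * Real.sqrt t) ^ 2 = t * Real.log t ^ 2 / 4 := by
    rw [mul_pow, h3]
    ring
  linarith

/-! The samples -/

variable {X Y : Type*} {p : PMF (X × Y)} {Ω : Type*} {Z : ℕ → Ω → X × Y}

/-- The logarithmic loss of `p(y|x)` on one sample. -/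
noncomputable def pointLoss (p : PMF (X × Y)) (z : X × Y) : ℝ≥0∞ := negLog (condProb p z.1 z.2)

theorem pointLoss_ne_top {z : X × Y} (h : p z ≠ 0) : pointLoss p z ≠ ⊤ :=
  negLog_ne_top (condProb_ne_zero h)

theorem loss_condProb_eq_ofReal_sum {N : ℕ} {ω : Ω} (h : ∀ k, p (Z k ω) ≠ 0) :
    loss (condProb p) (sample Z N ω)
      = ENNReal.ofReal (∑ k ∈ Finset.range N, (pointLoss p (Z k ω)).toReal) := by
  rw [ENNReal.ofReal_sum_of_nonneg fun _ _ => ENNReal.toReal_nonneg, Finset.sum_range]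
  exact Finset.sum_congr rfl fun k _ => (ENNReal.ofReal_toReal (pointLoss_ne_top (h k))).symm

theorem loss_condProb_deviation {N : ℕ} {ω : Ω} (h : ∀ k, p (Z k ω) ≠ 0)
    (hH : condEntropy p ≠ ⊤) {δ : ℝ}
    (hδ : |∑ k ∈ Finset.range N, (pointLoss p (Z k ω)).toReal - N * (condEntropy p).toReal| ≤ δ) :
    loss (condProb p) (sample Z N ω) ≤ N * condEntropy p + ENNReal.ofReal δ ∧
    N * condEntropy p ≤ loss (condProb p) (sample Z N ω) + ENNReal.ofReal δ := by
  have hNH : N * condEntropy p = ENNReal.ofReal (N * (condEntropy p).toReal) := by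
    rw [ENNReal.ofReal_mul (by positivity), ENNReal.ofReal_toReal hH, ENNReal.ofReal_natCast]
  rw [loss_condProb_eq_ofReal_sum h, hNH]
  exact ⟨ofReal_le_ofReal_add_of_abs_sub_le hδ,
    ofReal_le_ofReal_add_of_abs_sub_le (by rwa [abs_sub_comm])⟩

variable [MeasurableSpace Ω] {μ : Measure Ω}
  [Countable X] [Countable Y] [MeasurableSpace X] [DiscreteMeasurableSpace X]
  [MeasurableSpace Y] [DiscreteMeasurableSpace Y]

theorem lintegral_comp_sample (hmeas : ∀ i, Measurable (Z i))
    (hlaw : ∀ i, μ.map (Z i) = p.toMeasure) (f : X × Y → ℝ≥0∞) (k : ℕ) :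
    ∫⁻ ω, f (Z k ω) ∂μ = ∑' z, p z * f z := by
  rw [← lintegral_map (Measurable.of_discrete (f := f)) (hmeas k), hlaw k, lintegral_countable']
  refine tsum_congr fun z => ?_
  rw [PMF.toMeasure_apply_singleton _ _ (measurableSet_singleton z), mul_comm]

theorem ae_forall_apply_ne_zero (hmeas : ∀ i, Measurable (Z i))
    (hlaw : ∀ i, μ.map (Z i) = p.toMeasure) : ∀ᵐ ω ∂μ, ∀ k, p (Z k ω) ≠ 0 := by
  refine ae_all_iff.2 fun k => ?_
  have : ∀ᵐ z ∂(μ.map (Z k)), p z ≠ 0 := by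
    rw [hlaw k, ae_iff, PMF.toMeasure_apply_eq_zero_iff _ MeasurableSet.of_discrete]
    rw [Set.disjoint_left]
    intro z hz hz'
    exact hz' hz
  exact ae_of_ae_map (hmeas k).aemeasurable this

theorem measurable_comp_sample (hmeas : ∀ i, Measurable (Z i)) {N : ℕ} {β : Type*}
    [MeasurableSpace β] (f : (Fin N → X × Y) → β) : Measurable fun ω => f (sample Z N ω) :=
  (Measurable.of_discrete (f := f)).comp (measurable_pi_lambda _ fun i => hmeas i)

theorem measurable_pointLoss (hmeas : ∀ i, Measurable (Z i)) (k : ℕ) :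
    Measurable fun ω => pointLoss p (Z k ω) :=
  (Measurable.of_discrete (f := pointLoss p)).comp (hmeas k)

theorem lintegral_loss_condProb (hmeas : ∀ i, Measurable (Z i))
    (hlaw : ∀ i, μ.map (Z i) = p.toMeasure) (N : ℕ) :
    ∫⁻ ω, loss (condProb p) (sample Z N ω) ∂μ = N * condEntropy p := by
  have h : ∀ k, ∫⁻ ω, pointLoss p (Z k ω) ∂μ = condEntropy p :=
    lintegral_comp_sample hmeas hlaw (pointLoss p)
  calc ∫⁻ ω, loss (condProb p) (sample Z N ω) ∂μ
      = ∫⁻ ω, ∑ i : Fin N, pointLoss p (Z i ω) ∂μ := rfl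
    _ = N * condEntropy p := by
      rw [lintegral_finsetSum _ fun (i : Fin N) _ => measurable_pointLoss (p := p) hmeas (i : ℕ)]
      simp [h]

theorem identDistrib_pointLoss (hmeas : ∀ i, Measurable (Z i))
    (hlaw : ∀ i, μ.map (Z i) = p.toMeasure) (i : ℕ) :
    IdentDistrib (fun ω => (pointLoss p (Z i ω)).toReal) (fun ω => (pointLoss p (Z 0 ω)).toReal)
      μ μ :=
  IdentDistrib.comp (f := Z i) (g := Z 0) (u := fun z => (pointLoss p z).toReal)
    ⟨(hmeas i).aemeasurable, (hmeas 0).aemeasurable, (hlaw i).trans (hlaw 0).symm⟩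
    Measurable.of_discrete

theorem indepFun_pointLoss (hindep : iIndepFun Z μ) :
    iIndepFun (fun k ω => (pointLoss p (Z k ω)).toReal) μ :=
  hindep.comp (fun _ z => (pointLoss p z).toReal) fun _ => Measurable.of_discrete

theorem integral_pointLoss (hmeas : ∀ i, Measurable (Z i))
    (hlaw : ∀ i, μ.map (Z i) = p.toMeasure) (k : ℕ) :
    ∫ ω, (pointLoss p (Z k ω)).toReal ∂μ = (condEntropy p).toReal := by
  rw [integral_toReal (measurable_pointLoss hmeas k).aemeasurable]
  · rw [lintegral_comp_sample hmeas hlaw (pointLoss p)]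
    rfl
  · filter_upwards [ae_forall_apply_ne_zero hmeas hlaw] with ω hω
    exact (pointLoss_ne_top (hω k)).lt_top

/-- The law of large numbers for the loss of `p(y|x)`. -/
theorem ae_eventually_loss_condProb_deviation (hmeas : ∀ i, Measurable (Z i))
    (hindep : iIndepFun Z μ) (hlaw : ∀ i, μ.map (Z i) = p.toMeasure)
    (hH : condEntropy p ≠ ⊤) {ε : ℝ} (hε : 0 < ε) :
    ∀ᵐ ω ∂μ, ∀ᶠ N : ℕ in atTop,
      loss (condProb p) (sample Z N ω) ≤ N * condEntropy p + ENNReal.ofReal (ε * N) ∧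
      N * condEntropy p ≤ loss (condProb p) (sample Z N ω) + ENNReal.ofReal (ε * N) := by
  have hint : Integrable (fun ω => (pointLoss p (Z 0 ω)).toReal) μ :=
    integrable_toReal_of_lintegral_ne_top
      (measurable_pointLoss hmeas 0).aemeasurable
      (by rw [lintegral_comp_sample hmeas hlaw (pointLoss p)]; exact hH)
  have hlln := strong_law_ae_real (fun k ω => (pointLoss p (Z k ω)).toReal) hint
    (fun i j hij => (indepFun_pointLoss hindep).indepFun hij)
    (identDistrib_pointLoss hmeas hlaw)
  rw [integral_pointLoss hmeas hlaw] at hlln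
  filter_upwards [hlln, ae_forall_apply_ne_zero hmeas hlaw] with ω hω hsupp
  filter_upwards [Metric.tendsto_nhds.1 hω ε hε, eventually_gt_atTop 0] with N hN hpos
  refine loss_condProb_deviation hsupp hH ?_
  have hN0 : (0 : ℝ) < N := Nat.cast_pos.2 hpos
  rw [Real.dist_eq] at hN
  have : ∑ k ∈ Finset.range N, (pointLoss p (Z k ω)).toReal - N * (condEntropy p).toReal
      = ((∑ k ∈ Finset.range N, (pointLoss p (Z k ω)).toReal) / N - (condEntropy p).toReal) * N := by
    field_simp
  rw [this, abs_mul, abs_of_pos hN0]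
  gcongr

/-- The second moment is a sum of `p(x) t log² t` with `t = p(y|x)`, and `t log² t ≤ 4`, so it is at
most `4 |Y|`, however small the probabilities are. -/
theorem memLp_pointLoss [Finite Y] (hmeas : ∀ i, Measurable (Z i))
    (hlaw : ∀ i, μ.map (Z i) = p.toMeasure) (k : ℕ) :
    MemLp (fun ω => (pointLoss p (Z k ω)).toReal) 2 μ := by
  have := Fintype.ofFinite Y
  have hm : Measurable fun ω => (pointLoss p (Z k ω)).toReal :=
    (measurable_pointLoss hmeas k).ennreal_toReal
  rw [memLp_two_iff_integrable_sq hm.aestronglyMeasurable]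
  refine ⟨(hm.pow_const 2).aestronglyMeasurable, ?_⟩
  rw [hasFiniteIntegral_iff_ofReal (ae_of_all _ fun ω => sq_nonneg _),
    lintegral_comp_sample hmeas hlaw (fun z => ENNReal.ofReal ((pointLoss p z).toReal ^ 2))]
  have hle : ∀ z, p z * ENNReal.ofReal ((pointLoss p z).toReal ^ 2)
      ≤ (p.map Prod.fst) z.1 * 4 := fun z => by
    by_cases hz : p z = 0
    · simp [hz]
    have hc0 := condProb_ne_zero hz
    obtain ⟨h0, h1⟩ := toReal_pos_le_one hc0 (condProb_le_one p z.1 z.2)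
    rw [← marginal_mul_condProb p z.1 z.2, mul_assoc, pointLoss, negLog_of_ne_zero hc0,
      ENNReal.toReal_ofReal (by simpa using Real.log_nonpos h0.le h1), neg_sq]
    refine mul_le_mul_right ?_ _
    rw [← ENNReal.ofReal_toReal (a := condProb p z.1 z.2) (ne_top_of_le_ne_top
      ENNReal.one_ne_top (condProb_le_one p _ _)), ENNReal.toReal_ofReal h0.le,
      ← ENNReal.ofReal_mul h0.le]
    exact (ENNReal.ofReal_le_ofReal (mul_log_sq_le_four h0 h1)).trans (by simp)
  refine (ENNReal.tsum_le_tsum hle).trans_lt ?_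
  rw [ENNReal.tsum_prod (f := fun x (_ : Y) => (p.map Prod.fst) x * 4)]
  simp_rw [tsum_fintype, Finset.sum_const, nsmul_eq_mul]
  rw [ENNReal.tsum_mul_left, ENNReal.tsum_mul_right, PMF.tsum_coe]
  finiteness

theorem condEntropy_ne_top [IsProbabilityMeasure μ] [Finite Y] (hmeas : ∀ i, Measurable (Z i))
    (hlaw : ∀ i, μ.map (Z i) = p.toMeasure) : condEntropy p ≠ ⊤ := by
  have hint := (memLp_pointLoss hmeas hlaw 0).integrable one_le_two
  have h := (hasFiniteIntegral_iff_ofReal (ae_of_all _ fun ω => ENNReal.toReal_nonneg)).1 hint.2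
  have hH : ∫⁻ ω, pointLoss p (Z 0 ω) ∂μ = condEntropy p :=
    lintegral_comp_sample hmeas hlaw (pointLoss p) 0
  rw [← hH]
  refine ne_of_lt (lt_of_eq_of_lt (lintegral_congr_ae ?_) h)
  filter_upwards [ae_forall_apply_ne_zero hmeas hlaw] with ω hω
  exact (ENNReal.ofReal_toReal (pointLoss_ne_top (hω 0))).symm

/-- Chebyshev's inequality for the loss of `p(y|x)`. -/
theorem exists_measure_deviation_le [IsProbabilityMeasure μ] [Finite Y]
    (hmeas : ∀ i, Measurable (Z i)) (hindep : iIndepFun Z μ)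
    (hlaw : ∀ i, μ.map (Z i) = p.toMeasure) {ε : ℝ} (hε : 0 < ε) :
    ∃ c : ℝ, ∀ N : ℕ, 0 < N →
      μ {ω | c * Real.sqrt N
        ≤ |∑ k ∈ Finset.range N, (pointLoss p (Z k ω)).toReal - N * (condEntropy p).toReal|}
      ≤ ENNReal.ofReal ε := by
  set v := variance (fun ω => (pointLoss p (Z 0 ω)).toReal) μ with hv
  have hv0 : 0 ≤ v := variance_nonneg _ _
  -- With `c² = (v + 1) / ε` Chebyshev's bound `N v / (c² N)` is at most `ε`. The `+ 1` keeps `c`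
  -- positive when the variance vanishes.
  have hc : 0 < Real.sqrt ((v + 1) / ε) := Real.sqrt_pos.2 (by positivity)
  refine ⟨Real.sqrt ((v + 1) / ε), fun N hN => ?_⟩
  have hN0 : (0 : ℝ) < N := Nat.cast_pos.2 hN
  have hLp := memLp_pointLoss hmeas hlaw (μ := μ) (p := p)
  have hsum : MemLp (∑ k ∈ Finset.range N, fun ω => (pointLoss p (Z k ω)).toReal) 2 μ :=
    memLp_finsetSum' _ fun k _ => hLp k
  have hvar : variance (∑ k ∈ Finset.range N, fun ω => (pointLoss p (Z k ω)).toReal) μ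
      = N * v := by
    rw [IndepFun.variance_sum (fun k _ => hLp k)
      fun i _ j _ hij => (indepFun_pointLoss hindep).indepFun hij,
      Finset.sum_congr rfl fun k _ => (identDistrib_pointLoss hmeas hlaw k).variance_eq]
    simp [hv]
  have hmean : μ[∑ k ∈ Finset.range N, fun ω => (pointLoss p (Z k ω)).toReal]
      = N * (condEntropy p).toReal := by
    simp only [Finset.sum_apply]
    rw [integral_finsetSum _ fun k _ => (hLp k).integrable one_le_two]
    simp [integral_pointLoss hmeas hlaw]
  have hcheb := meas_ge_le_variance_div_sq hsum (mul_pos hc (Real.sqrt_pos.2 hN0))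
  rw [hmean, hvar] at hcheb
  simp only [Finset.sum_apply] at hcheb
  refine hcheb.trans (ENNReal.ofReal_le_ofReal ?_)
  rw [mul_pow, Real.sq_sqrt (by positivity), Real.sq_sqrt hN0.le,
    div_le_iff₀ (by positivity)]
  have : ε * ((v + 1) / ε * N) = (v + 1) * N := by field_simp
  rw [this]
  nlinarith

end

section

open Filter Topology

/-! The task complexity of a random dataset -/

variable {X Y : Type*} [Primcodable X] [Primcodable Y]
  [MeasurableSpace X] [DiscreteMeasurableSpace X] [MeasurableSpace Y] [DiscreteMeasurableSpace Y]
  {U : List Bool →. ℕ} {p : PMF (X × Y)} {Ω : Type*} [MeasurableSpace Ω] {μ : Measure Ω}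
  {Z : ℕ → Ω → X × Y}

theorem lintegral_likelihoodRatio_le_one (hmeas : ∀ i, Measurable (Z i))
    (hlaw : ∀ i, μ.map (Z i) = p.toMeasure) (q : X → PMF Y) (k : ℕ) :
    ∫⁻ ω, likelihoodRatio p q (Z k ω) ∂μ ≤ 1 :=
  (lintegral_comp_sample hmeas hlaw (likelihoodRatio p q) k).trans_le
    (tsum_mul_likelihoodRatio_le_one p q)

theorem mul_condEntropy_le_lintegral_taskComplexity (hU : IsUniversalPrefixMachine U)
    [IsProbabilityMeasure μ] (hmeas : ∀ i, Measurable (Z i)) (hindep : iIndepFun Z μ)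
    (hlaw : ∀ i, μ.map (Z i) = p.toMeasure) (N : ℕ) :
    N * condEntropy p ≤ ∫⁻ ω, taskComplexity U (sample Z N ω) ∂μ := by
  have hmix := (lintegral_tsum_mul_prod_le (w := fun i : Algorithm X Y => i.weight U)
    (r := fun i => likelihoodRatio p i.dist) hmeas hindep (fun _ => Measurable.of_discrete)
    (fun i => lintegral_likelihoodRatio_le_one hmeas hlaw i.dist) N).trans
    (Algorithm.tsum_weight_le_one hU)
  -- Only the finite constant 1 is cancelled, so the argument also covers infinite entropy.
  refine (ENNReal.add_le_add_iff_right ENNReal.one_ne_top).1 ?_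
  calc N * condEntropy p + 1
      = ∫⁻ ω, (loss (condProb p) (sample Z N ω) + 1) ∂μ := by
        rw [lintegral_add_right _ measurable_const, lintegral_loss_condProb hmeas hlaw]
        simp
    _ ≤ ∫⁻ ω, (taskComplexity U (sample Z N ω) + ∑' i : Algorithm X Y,
          i.weight U * ∏ j ∈ Finset.range N, likelihoodRatio p i.dist (Z j ω)) ∂μ := by
        refine lintegral_mono_ae ?_
        filter_upwards [ae_forall_apply_ne_zero hmeas hlaw] with ω hω
        simp_rw [Finset.prod_range]
        exact loss_condProb_add_one_le_taskComplexity hU fun k => hω k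
    _ ≤ ∫⁻ ω, taskComplexity U (sample Z N ω) ∂μ + 1 := by
        rw [lintegral_add_left (measurable_comp_sample hmeas (taskComplexity U))]
        gcongr

theorem lintegral_taskComplexity_le (hU : IsUniversalPrefixMachine U)
    (hp : HasComputableConditional p)
    [IsProbabilityMeasure μ] (hmeas : ∀ i, Measurable (Z i))
    (hlaw : ∀ i, μ.map (Z i) = p.toMeasure) (N : ℕ) :
    ∫⁻ ω, taskComplexity U (sample Z N ω) ∂μ
      ≤ N * condEntropy p + conditionalComplexity U p := by
  calc ∫⁻ ω, taskComplexity U (sample Z N ω) ∂μ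
      ≤ ∫⁻ ω, (loss (condProb p) (sample Z N ω) + conditionalComplexity U p) ∂μ := by
        refine lintegral_mono_ae ?_
        filter_upwards [ae_forall_apply_ne_zero hmeas hlaw] with ω hω
        exact taskComplexity_le hU hp fun k => hω k
    _ = N * condEntropy p + conditionalComplexity U p := by
        rw [lintegral_add_right _ measurable_const, lintegral_loss_condProb hmeas hlaw]
        simp

theorem ae_eventually_taskComplexity_eq (hU : IsUniversalPrefixMachine U)
    (hp : HasComputableConditional p) [IsProbabilityMeasure μ] (hmeas : ∀ i, Measurable (Z i))
    (hindep : iIndepFun Z μ) (hlaw : ∀ i, μ.map (Z i) = p.toMeasure) :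
    ∀ᵐ ω ∂μ, ∀ᶠ N : ℕ in atTop,
      taskComplexity U (sample Z N ω)
        = loss (condProb p) (sample Z N ω) + conditionalComplexity U p ∧
      ∀ q : X → PMF Y, IsComputable q →
        (taskComplexity U (sample Z N ω)
            = loss (fun x y => q x y) (sample Z N ω) + complexity U q
          ↔ IsConditional p q ∧ complexity U q = conditionalComplexity U p) := by
  obtain ⟨i₀, -, hK⟩ := Algorithm.exists_conditionalComplexity_eq hU hp
  have hsum : ∑' i : {i : Algorithm X Y // ¬ IsConditional p i.dist}, i.1.weight U ≠ ⊤ :=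
    ne_top_of_le_ne_top ENNReal.one_ne_top ((ENNReal.tsum_comp_le_tsum_of_injective
      Subtype.val_injective fun i : Algorithm X Y => i.weight U).trans
      (Algorithm.tsum_weight_le_one hU))
  -- The level `a` is the weight of a shortest algorithm for `p(y|x)`: staying below it means losing
  -- to that algorithm.
  have hsmall := ae_eventually_forall_mul_prod_lt
    (w := fun i : {i : Algorithm X Y // ¬ IsConditional p i.dist} => i.1.weight U)
    (r := fun i => likelihoodRatio p i.1.dist) (a := i₀.weight U) hmeas hindep (fun _ => Measurable.of_discrete)
    (fun i => lintegral_likelihoodRatio_le_one hmeas hlaw i.1.dist) hsum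
    i₀.weight_ne_zero i₀.weight_ne_top fun i =>
      ae_tendsto_prod_zero hmeas hindep Measurable.of_discrete
        (tsum_mul_sqrt_likelihoodRatio_lt_one i.2)
        fun k => (lintegral_comp_sample hmeas hlaw
          (fun z => likelihoodRatio p i.1.dist z ^ (1 / 2 : ℝ)) k).le
  filter_upwards [hsmall, ae_forall_apply_ne_zero hmeas hlaw] with ω hω hsupp
  filter_upwards [hω] with N hN
  refine taskComplexity_eq_and_minimizer_iff hU hp (fun k => hsupp k) fun i hi => ?_
  rw [hK]
  refine loss_condProb_add_negLog_lt i.dist i₀.weight_le_one i.weight_le_one (fun k => hsupp k) ?_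
  have := hN ⟨i, hi⟩
  rwa [Finset.prod_range] at this

theorem exists_taskComplexity_sqrt_deviation (hU : IsUniversalPrefixMachine U)
    (hp : HasComputableConditional p) [IsProbabilityMeasure μ] (hmeas : ∀ i, Measurable (Z i))
    (hindep : iIndepFun Z μ) (hlaw : ∀ i, μ.map (Z i) = p.toMeasure) [Finite Y]
    {ε : ℝ} (hε : 0 < ε) :
    ∃ (N₀ : ℕ) (c : ℝ), ∀ N : ℕ, N₀ ≤ N → 1 - ENNReal.ofReal ε ≤ μ {ω |
      taskComplexity U (sample Z N ω)
        ≤ N * condEntropy p + conditionalComplexity U p + ENNReal.ofReal (c * Real.sqrt N) ∧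
      N * condEntropy p + conditionalComplexity U p
        ≤ taskComplexity U (sample Z N ω) + ENNReal.ofReal (c * Real.sqrt N)} := by
  have hH : condEntropy p ≠ ⊤ := condEntropy_ne_top hmeas hlaw
  obtain ⟨c, hc⟩ := exists_measure_deviation_le hmeas hindep hlaw (half_pos hε)
  obtain ⟨N₀, hN₀⟩ := exists_le_measure_forall_ge
    (((ae_eventually_taskComplexity_eq hU hp hmeas hindep hlaw).mono fun ω hω =>
      hω.mono fun N hN => hN.1).and
      ((ae_forall_apply_ne_zero hmeas hlaw).mono fun ω hω => Eventually.of_forall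
        (f := atTop) fun _ : ℕ => hω) |>.mono fun ω hω => hω.1.and hω.2) (half_pos hε)
  -- `N = 0` is excluded: the threshold `c √N` would be zero, and Chebyshev's inequality says
  -- nothing there.
  refine ⟨max N₀ 1, c, fun N hN => ?_⟩
  have hN1 : N₀ ≤ N := (le_max_left _ _).trans hN
  have hNpos : 0 < N := (le_max_right _ _).trans hN
  set A := {ω | ∀ N : ℕ, N₀ ≤ N → taskComplexity U (sample Z N ω)
    = loss (condProb p) (sample Z N ω) + conditionalComplexity U p ∧ ∀ k, p (Z k ω) ≠ 0}
  set B := {ω | c * Real.sqrt N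
    ≤ |∑ k ∈ Finset.range N, (pointLoss p (Z k ω)).toReal - N * (condEntropy p).toReal|}
  have hsub : A \ B ⊆ {ω | taskComplexity U (sample Z N ω)
        ≤ N * condEntropy p + conditionalComplexity U p + ENNReal.ofReal (c * Real.sqrt N) ∧
      N * condEntropy p + conditionalComplexity U p
        ≤ taskComplexity U (sample Z N ω) + ENNReal.ofReal (c * Real.sqrt N)} := by
    rintro ω ⟨hA, hB⟩
    obtain ⟨heq, hsupp⟩ := hA N hN1
    exact taskComplexity_deviation heq (loss_condProb_deviation hsupp hH (not_le.1 hB).le)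
  calc 1 - ENNReal.ofReal ε
      = 1 - ENNReal.ofReal (ε / 2) - ENNReal.ofReal (ε / 2) := by
        rw [tsub_tsub, ← ENNReal.ofReal_add (by positivity) (by positivity), add_halves]
    _ ≤ μ A - μ B := tsub_le_tsub hN₀ (hc N hNpos)
    _ ≤ μ (A \ B) := le_measure_sdiff
    _ ≤ _ := measure_mono hsub

end

end TaskComplexity

theorem mainTheorem5
    {X Y : Type*} [Primcodable X] [Primcodable Y]
    [MeasurableSpace X] [DiscreteMeasurableSpace X]
    [MeasurableSpace Y] [DiscreteMeasurableSpace Y]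
    (U : List Bool →. ℕ) (hU : TaskComplexity.IsUniversalPrefixMachine U)
    (p : PMF (X × Y)) (hp : TaskComplexity.HasComputableConditional p)
    {Ω : Type*} [MeasurableSpace Ω] (μ : Measure Ω) [IsProbabilityMeasure μ]
    (Z : ℕ → Ω → X × Y) (hmeas : ∀ i, Measurable (Z i))
    (hindep : iIndepFun Z μ) (hlaw : ∀ i, μ.map (Z i) = p.toMeasure) :
    -- bounds on the expected complexity of `N` samples
    (∀ N : ℕ,
      N * TaskComplexity.condEntropy p
        ≤ ∫⁻ ω, TaskComplexity.taskComplexity U (TaskComplexity.sample Z N ω) ∂μ ∧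
      ∫⁻ ω, TaskComplexity.taskComplexity U (TaskComplexity.sample Z N ω) ∂μ
        ≤ N * TaskComplexity.condEntropy p + TaskComplexity.conditionalComplexity U p) ∧
    -- with probability at least `1 - ε`, simultaneously for all `N ≥ N₀`
    (∀ ε : ℝ, 0 < ε → ∃ N₀ : ℕ,
      1 - ENNReal.ofReal ε ≤ μ {ω | ∀ N : ℕ, N₀ ≤ N →
        TaskComplexity.taskComplexity U (TaskComplexity.sample Z N ω)
          = TaskComplexity.loss (TaskComplexity.condProb p) (TaskComplexity.sample Z N ω)
            + TaskComplexity.conditionalComplexity U p ∧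
        (∀ q : X → PMF Y, TaskComplexity.IsComputable q →
          (TaskComplexity.taskComplexity U (TaskComplexity.sample Z N ω)
              = TaskComplexity.loss (fun x y => q x y) (TaskComplexity.sample Z N ω)
                + TaskComplexity.complexity U q
            ↔ TaskComplexity.IsConditional p q ∧
              TaskComplexity.complexity U q = TaskComplexity.conditionalComplexity U p)) ∧
        (TaskComplexity.condEntropy p ≠ ⊤ →
          TaskComplexity.taskComplexity U (TaskComplexity.sample Z N ω)
            ≤ N * TaskComplexity.condEntropy p + TaskComplexity.conditionalComplexity U p
              + ENNReal.ofReal (ε * N) ∧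
          N * TaskComplexity.condEntropy p + TaskComplexity.conditionalComplexity U p
            ≤ TaskComplexity.taskComplexity U (TaskComplexity.sample Z N ω)
              + ENNReal.ofReal (ε * N))}) ∧
    -- for finitely many labels the deviation from `N * H + K` is of order `√N` in probability
    (Finite Y → ∀ ε : ℝ, 0 < ε → ∃ (N₀ : ℕ) (c : ℝ), ∀ N : ℕ, N₀ ≤ N →
      1 - ENNReal.ofReal ε ≤ μ {ω |
        TaskComplexity.taskComplexity U (TaskComplexity.sample Z N ω)
          ≤ N * TaskComplexity.condEntropy p + TaskComplexity.conditionalComplexity U p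
            + ENNReal.ofReal (c * Real.sqrt N) ∧
        N * TaskComplexity.condEntropy p + TaskComplexity.conditionalComplexity U p
          ≤ TaskComplexity.taskComplexity U (TaskComplexity.sample Z N ω)
            + ENNReal.ofReal (c * Real.sqrt N)}) := by
  refine ⟨fun N => ⟨?_, ?_⟩, fun ε hε => ?_, fun _ ε hε => ?_⟩
  · exact TaskComplexity.mul_condEntropy_le_lintegral_taskComplexity hU hmeas hindep hlaw N
  · exact TaskComplexity.lintegral_taskComplexity_le hU hp hmeas hlaw N
  · refine TaskComplexity.exists_le_measure_forall_ge ?_ hε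
    have hmin := TaskComplexity.ae_eventually_taskComplexity_eq hU hp hmeas hindep hlaw
    -- The law of large numbers needs an integrable loss; for infinite entropy the last claim is
    -- vacuous.
    by_cases hH : TaskComplexity.condEntropy p = ⊤
    · filter_upwards [hmin] with ω hω
      exact hω.mono fun N hN => ⟨hN.1, hN.2, fun h => absurd hH h⟩
    · filter_upwards [hmin, TaskComplexity.ae_eventually_loss_condProb_deviation hmeas hindep hlaw
        hH hε] with ω hω hdev
      exact (hω.and hdev).mono fun N hN => ⟨hN.1.1, hN.1.2, fun _ =>
        TaskComplexity.taskComplexity_deviation hN.1.1 hN.2⟩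
  · exact TaskComplexity.exists_taskComplexity_sqrt_deviation hU hp hmeas hindep hlaw hε
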